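/- Let $n\ge 1$, let $S_n$ be the symmetric group on $\{0,\dots,n-1\}$, let $P_\sigma$ ($\sigma\in S_n$) be the $n\times n$ permutation matrix with $P_\sigma e_j=e_{\sigma(j)}$, and let $F_n=\frac{1}{\sqrt n}(\omega^{jk})_{0\le j,k<n}$, $\omega=e^{2\pi i/n}$, be the Fourier matrix. Let $XU(n)$ be the set of unitary $n\times n$ complex matrices all of whose row sums and column sums equal $1$. Let $D^{(s)}(\sigma)$ be the $(n-1)\times(n-1)$ matrix obtained from $F_n^\dagger P_\sigma F_n$ by deleting the first row and the first column. There is a complete list $(D^{(\nu)})_\nu$ of the complex irreducible representations of $S_n$, with exactly one representative of every isomorphism class, each written by unitary matrices of size $n_\nu=\dim D^{(\nu)}$, which, if $n\ge 2$, contains the standard representation in the form $D^{(s)}$. For every $X\in XU(n)$: (a) There are complex numbers $c_\sigma$ with $X=\sum_{\sigma\in S_n}c_\sigma P_\sigma$, $\sum_\sigma c_\sigma=1$ and $\sum_\sigma|c_\sigma|^2=1$. (b) There is a unitary $(n-1)\times(n-1)$ matrix $U^{(s)}$ with $$F_n^\dagger XF_n=\begin{pmatrix}1&0\\0&U^{(s)}\end{pmatrix},$$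 and for every list $(D^{(\nu)})_\nu$ as above the following holds. Attach to the trivial representation the matrix $U^{(0)}=1$, to the standard representation $D^{(s)}$ (if $n\ge2$) the matrix $U^{(s)}$, and to every other $D^{(\nu)}$ an arbitrary unitary $n_\nu\times n_\nu$ matrix $U^{(\nu)}$; such choices exist. Then the coefficients $$c_\sigma=\frac1{n!}\sum_\nu n_\nu\,\mathrm{Tr}\bigl(D^{(\nu)}(\sigma)^\dagger U^{(\nu)}\bigr)=\frac1{n!}\sum_\nu n_\nu\sum_{i,j=1}^{n_\nu}\overline{D^{(\nu)}_{ij}(\sigma)}\,U^{(\nu)}_{ij}$$ satisfy $$X=\sum_{\sigma\in S_n}c_\sigma P_\sigma,\qquad \sum_{\sigma\in S_n}c_\sigma=1,\qquad \sum_{\sigma\in S_n}|c_\sigma|^2=1.$$ -/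

import Mathlib

open scoped Matrix

/-- `XU(n)`: the complex unitary `n × n` matrices all of whose row sums and column sums are `1`. -/
def XU (n : ℕ) : Set (Matrix (Fin n) (Fin n) ℂ) :=
  {X | X ∈ Matrix.unitaryGroup (Fin n) ℂ ∧ (∀ i, ∑ j, X i j = 1) ∧ (∀ j, ∑ i, X i j = 1)}

/-- The permutation matrix `P_σ`, with `P_σ e_j = e_{σ j}`; the map `σ ↦ P_σ` is a homomorphism. -/
def permMat {n : ℕ} (σ : Equiv.Perm (Fin n)) : Matrix (Fin n) (Fin n) ℂ :=
  Matrix.permMatrixHom σ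

theorem permMat_apply {n : ℕ} (σ : Equiv.Perm (Fin n)) (i j : Fin n) :
    permMat σ i j = if i = σ j then 1 else 0 := by
  have h : σ⁻¹ i = j ↔ i = σ j := Equiv.Perm.inv_eq_iff_eq
  simp only [permMat, Matrix.permMatrixHom_apply, Equiv.Perm.permMatrix, PEquiv.toMatrix_apply,
    Equiv.toPEquiv_apply, Option.mem_some_iff, h]

/-- The Fourier matrix `F_n`, with entries `ω ^ (j k) / √n` for `ω = exp (2 π i / n)`
and `0 ≤ j, k < n`. -/
noncomputable def fourierMat (n : ℕ) : Matrix (Fin n) (Fin n) ℂ :=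
  Matrix.of fun j k =>
    Complex.exp (2 * Real.pi * Complex.I / n) ^ ((j : ℕ) * (k : ℕ)) / (Real.sqrt n : ℂ)

/-- The block diagonal matrix `1 ⊕ U`. -/
def oneDirectSum {m : ℕ} (U : Matrix (Fin m) (Fin m) ℂ) : Matrix (Fin (m + 1)) (Fin (m + 1)) ℂ :=
  Matrix.of (Fin.cons (Fin.cons 1 0) fun i => Fin.cons 0 (U i))

/-- The standard representation `D^{(s)}` of the symmetric group on `m + 1` letters: the matrix
`F† P_σ F` with its first row and first column deleted. -/
noncomputable def standardMat {m : ℕ} (σ : Equiv.Perm (Fin (m + 1))) : Matrix (Fin m) (Fin m) ℂ :=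
  ((fourierMat (m + 1))ᴴ * permMat σ * fourierMat (m + 1)).submatrix Fin.succ Fin.succ

/-- The linear representation on `ℂ ^ d` given by a representation by unitary `d × d` matrices. -/
noncomputable def toRep {G : Type} [Group G] {d : ℕ} (D : G →* Matrix.unitaryGroup (Fin d) ℂ) :
    Representation ℂ G (Fin d → ℂ) :=
  (Matrix.toLinAlgEquiv' : Matrix (Fin d) (Fin d) ℂ ≃ₐ[ℂ] _).toMonoidHom.comp
    ((Matrix.unitaryGroup (Fin d) ℂ).subtype.comp D)

/-- A finite list of all complex irreducible representations of `G`, each one written by unitary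
matrices: exactly one representative of every isomorphism class. -/
structure IrrepSystem (G : Type) [Group G] where
  /-- The number of irreducible representations. -/
  k : ℕ
  /-- The dimension of the irreducible representation number `ν`. -/
  dim : Fin k → ℕ
  /-- The matrices of the irreducible representation number `ν`. -/
  D : ∀ ν, G →* Matrix.unitaryGroup (Fin (dim ν)) ℂ
  irreducible : ∀ ν, (toRep (D ν)).IsIrreducible
  inequivalent : ∀ μ ν, Nonempty ((toRep (D μ)).Equiv (toRep (D ν))) → μ = ν
  complete : ∀ (d : ℕ) (ρ : Representation ℂ G (Fin d → ℂ)), ρ.IsIrreducible →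
    ∃ ν, Nonempty (ρ.Equiv (toRep (D ν)))

namespace IrrepSystem

/-- Number `ν` is the trivial representation. -/
def IsTrivial {G : Type} [Group G] (S : IrrepSystem G) (ν : Fin S.k) : Prop :=
  ∀ g, S.D ν g = 1

/-- Number `ν` is the standard representation, in the very matrix form `D^{(s)}`. -/
def IsStandard {m : ℕ} (S : IrrepSystem (Equiv.Perm (Fin (m + 1)))) (ν : Fin S.k) : Prop :=
  ∃ h : S.dim ν = m, ∀ σ, (S.D ν σ : Matrix (Fin (S.dim ν)) (Fin (S.dim ν)) ℂ) =
    (standardMat σ).submatrix (Fin.cast h) (Fin.cast h)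

/-- The system represents the class of the standard representation by `D^{(s)}` itself. (On one
letter, that is for `m = 0`, `D^{(s)}` has dimension `0` and is not among the irreducible ones.) -/
def HasStandard {m : ℕ} (S : IrrepSystem (Equiv.Perm (Fin (m + 1)))) : Prop :=
  0 < m → ∃ ν, S.IsStandard ν

/-- The unitary matrices `U^{(ν)}` are arbitrary, but for `U^{(ν)} = 1` at the trivial
representation and `U^{(ν)} = Us` at the standard representation. -/
def Admissible {m : ℕ} (S : IrrepSystem (Equiv.Perm (Fin (m + 1))))
    (Us : Matrix (Fin m) (Fin m) ℂ)
    (U : ∀ ν, Matrix.unitaryGroup (Fin (S.dim ν)) ℂ) : Prop :=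
  (∀ ν, S.IsTrivial ν → U ν = 1) ∧
  ∀ ν, S.IsStandard ν → ∀ h : S.dim ν = m,
    (U ν : Matrix (Fin (S.dim ν)) (Fin (S.dim ν)) ℂ) = Us.submatrix (Fin.cast h) (Fin.cast h)

/-- `c_σ = (1 / n!) ∑_ν n_ν Tr (D^{(ν)}(σ)† U^{(ν)})`. -/
noncomputable def coeff {n : ℕ} (S : IrrepSystem (Equiv.Perm (Fin n)))
    (U : ∀ ν, Matrix.unitaryGroup (Fin (S.dim ν)) ℂ) (σ : Equiv.Perm (Fin n)) : ℂ :=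
  (1 / (n.factorial : ℂ)) * ∑ ν, (S.dim ν : ℂ) *
    ((S.D ν σ : Matrix (Fin (S.dim ν)) (Fin (S.dim ν)) ℂ)ᴴ *
      (U ν : Matrix (Fin (S.dim ν)) (Fin (S.dim ν)) ℂ)).trace

end IrrepSystem

/-!
The coefficients `c_σ = (1 / n!) ∑_ν n_ν Tr (D^{(ν)}(σ)† U^{(ν)})` form the function on `S_n` whose
Fourier transform is `U`, that is `∑ σ, c_σ D^{(μ)}(σ) = U^{(μ)}` for every `μ`. This is Schur
orthogonality of the matrix coefficients (`IrrepSystem.sum_inverseFourier_smul`). At the trivial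
representation it says `∑ σ, c_σ = 1`. Conjugation by the Fourier matrix `F` turns every matrix of
`XU(n)` into a block matrix `1 ⊕ U`, because the first column of `F` is constant
(`eq_oneDirectSum_of_mem_XU`); for `P_σ` the second block is `D^{(s)}(σ)`. So inversion at the
trivial and at the standard representation gives `F† X F = F† (∑ σ, c_σ P_σ) F`.

The sum of the `|c_σ|²` equals `(1 / n!) ∑_ν n_ν Tr (U^{(ν)}† U^{(ν)}) = (1 / n!) ∑_ν n_ν²`
(`IrrepSystem.sum_norm_sq_inverseFourier`), and `∑_ν n_ν² = n!` since the Fourier transform is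
bijective (`IrrepSystem.sum_dim_sq`). It is onto by inversion, and one to one because the regular
representation is faithful and, by Maschke's theorem, a sum of irreducible ones.

A complete list of irreducible unitary representations exists for every finite group, and one may
prescribe one of its members (`exists_irrepSystem_of_isIrreducible`): averaging makes every
representation unitary, and orthogonality makes the matrix coefficients of inequivalent irreducible
representations linearly independent, so there are finitely many classes. The prescribed member is
`D^{(s)}`, which is irreducible (`standardHom_isIrreducible`) since a nonzero vector of sum zero
differs from its image under some transposition by a nonzero multiple of some `e_i - e_j`.
-/

/-! ### Schur orthogonality and unitarizability -/

section UnitaryRepresentations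

variable {G : Type} [Group G] {d e : ℕ}

theorem toRep_apply (D : G →* Matrix.unitaryGroup (Fin d) ℂ) (g : G) (v : Fin d → ℂ) :
    toRep D g v = (D g).1 *ᵥ v := rfl

theorem unitary_map_inv (D : G →* Matrix.unitaryGroup (Fin d) ℂ) (g : G) :
    (D g⁻¹).1 = (D g).1ᴴ := by
  rw [map_inv]; rfl

theorem isIrreducible_of_equiv {V W : Type*} [AddCommGroup V] [Module ℂ V]
    [AddCommGroup W] [Module ℂ W] {ρ : Representation ℂ G V} {τ : Representation ℂ G W}
    (φ : ρ.Equiv τ) (h : ρ.IsIrreducible) : τ.IsIrreducible := by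
  rw [Representation.irreducible_iff_isSimpleModule_asModule] at h ⊢
  let f := Representation.IntertwiningMap.equivLinearMapAsModule τ ρ φ.symm.toIntertwiningMap
  exact IsSimpleModule.congr (LinearEquiv.ofBijective f φ.symm.toLinearEquiv.bijective)

/-- A matrix intertwining two representations by matrices, as a map of representations. -/
noncomputable def matrixIntertwiner (D : G →* Matrix.unitaryGroup (Fin d) ℂ)
    (E : G →* Matrix.unitaryGroup (Fin e) ℂ) (M : Matrix (Fin d) (Fin e) ℂ)
    (h : ∀ g, (D g).1 * M = M * (E g).1) : (toRep E).IntertwiningMap (toRep D) :=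
  (Matrix.toLin' M).intertwiningMap_of_isIntertwiningMap _ _ fun g v => by
    simp [toRep_apply, Matrix.mulVec_mulVec, h]

theorem intertwiner_eq_zero {D : G →* Matrix.unitaryGroup (Fin d) ℂ}
    {E : G →* Matrix.unitaryGroup (Fin e) ℂ} (hD : (toRep D).IsIrreducible)
    (hE : (toRep E).IsIrreducible) (hDE : IsEmpty ((toRep E).Equiv (toRep D)))
    {M : Matrix (Fin d) (Fin e) ℂ} (h : ∀ g, (D g).1 * M = M * (E g).1) : M = 0 := by
  have h0 : matrixIntertwiner D E M h = 0 := Subsingleton.elim _ _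
  have h1 : Matrix.toLin' M = 0 :=
    congrArg Representation.IntertwiningMap.toLinearMap h0
  simpa using h1

theorem intertwiner_eq_smul_one {D : G →* Matrix.unitaryGroup (Fin d) ℂ}
    (hD : (toRep D).IsIrreducible) {M : Matrix (Fin d) (Fin d) ℂ}
    (h : ∀ g, (D g).1 * M = M * (D g).1) : ∃ a : ℂ, M = a • 1 := by
  obtain ⟨a, ha⟩ :=
    (Representation.IsIrreducible.algebraMap_intertwiningMap_bijective_of_isAlgClosed
      (ρ := toRep D)).2 (matrixIntertwiner D D M h)
  refine ⟨a, ?_⟩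
  have h1 : a • LinearMap.id = Matrix.toLin' M :=
    congrArg Representation.IntertwiningMap.toLinearMap ha
  apply Matrix.toLin'.injective
  rw [← h1, map_smul, Matrix.toLin'_one]

variable [Fintype G]

/-- Averaging an arbitrary matrix over the group yields an intertwiner. -/
theorem sum_conj_intertwines (D : G →* Matrix.unitaryGroup (Fin d) ℂ)
    (E : G →* Matrix.unitaryGroup (Fin e) ℂ) (A : Matrix (Fin d) (Fin e) ℂ) (h : G) :
    (D h).1 * ∑ g, (D g).1 * A * (E g).1ᴴ = (∑ g, (D g).1 * A * (E g).1ᴴ) * (E h).1 := by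
  rw [Matrix.mul_sum, Matrix.sum_mul]
  refine Fintype.sum_bijective (h * ·) (Group.mulLeft_bijective h) _ _ fun g => ?_
  have : (E g).1ᴴ = (E (h * g)).1ᴴ * (E h).1 := by
    rw [← unitary_map_inv, ← unitary_map_inv, ← Submonoid.coe_mul, ← map_mul]
    simp
  rw [this]
  simp [Matrix.mul_assoc]

theorem sum_conj_single_apply (D : G →* Matrix.unitaryGroup (Fin d) ℂ)
    (E : G →* Matrix.unitaryGroup (Fin e) ℂ) (k l : Fin d) (i j : Fin e) :
    (∑ g, (D g).1 * Matrix.single l j (1 : ℂ) * (E g).1ᴴ) k i =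
      ∑ g, (D g).1 k l * star ((E g).1 i j) := by
  rw [Matrix.sum_apply]
  refine Finset.sum_congr rfl fun g _ => ?_
  rw [Matrix.mul_apply, Finset.sum_eq_single j]
  · simp
  · intro b _ hb
    simp [hb]
  · simp

theorem schur_orthogonality_of_isEmpty {D : G →* Matrix.unitaryGroup (Fin d) ℂ}
    {E : G →* Matrix.unitaryGroup (Fin e) ℂ} (hD : (toRep D).IsIrreducible)
    (hE : (toRep E).IsIrreducible) (hDE : IsEmpty ((toRep E).Equiv (toRep D)))
    (k l : Fin d) (i j : Fin e) : ∑ g, (D g).1 k l * star ((E g).1 i j) = 0 := by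
  rw [← sum_conj_single_apply, intertwiner_eq_zero hD hE hDE (sum_conj_intertwines D E _)]
  rfl

theorem schur_orthogonality_self {D : G →* Matrix.unitaryGroup (Fin d) ℂ}
    (hD : (toRep D).IsIrreducible) (k l i j : Fin d) :
    (d : ℂ) * ∑ g, (D g).1 k l * star ((D g).1 i j) =
      if k = i ∧ l = j then (Fintype.card G : ℂ) else 0 := by
  obtain ⟨a, ha⟩ := intertwiner_eq_smul_one hD (sum_conj_intertwines D D (Matrix.single l j 1))
  -- The trace of the averaged matrix determines the scalar.
  have htr : (d : ℂ) * a = if l = j then (Fintype.card G : ℂ) else 0 := by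
    have h := congrArg Matrix.trace ha
    rw [Matrix.trace_sum, Matrix.trace_smul, Matrix.trace_one, Fintype.card_fin] at h
    have h2 : ∀ g, ((D g).1 * Matrix.single l j (1 : ℂ) * (D g).1ᴴ).trace =
        if l = j then 1 else 0 := fun g => by
      rw [Matrix.trace_mul_comm, ← Matrix.mul_assoc, ← Matrix.star_eq_conjTranspose,
        Matrix.UnitaryGroup.star_mul_self, Matrix.one_mul]
      split_ifs with hlj
      · subst hlj; simp
      · exact Matrix.trace_single_eq_of_ne _ _ _ hlj
    rw [Finset.sum_congr rfl fun g _ => h2 g] at h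
    rw [mul_comm, ← smul_eq_mul, ← h]
    split_ifs <;> simp
  rw [← sum_conj_single_apply, ha, Matrix.smul_apply, Matrix.one_apply, smul_eq_mul,
    ← mul_assoc, htr]
  by_cases h1 : k = i <;> by_cases h2 : l = j <;> simp [h1, h2]

/-- Every finite-dimensional complex representation of a finite group is unitarizable: if
`H = ∑ ρ(g)† ρ(g) = B† B`, then `B ρ(g) B⁻¹` is unitary. -/
theorem exists_equiv_toRep (ρ : Representation ℂ G (Fin d → ℂ)) :
    ∃ D : G →* Matrix.unitaryGroup (Fin d) ℂ, Nonempty (ρ.Equiv (toRep D)) := by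
  open scoped MatrixOrder ComplexOrder in
  let R : G →* Matrix (Fin d) (Fin d) ℂ :=
    (LinearMap.toMatrixAlgEquiv' : _ ≃ₐ[ℂ] Matrix (Fin d) (Fin d) ℂ).toMonoidHom.comp ρ
  let H := ∑ g, (R g)ᴴ * R g
  have hpos : H.PosDef := by
    classical
    have h1 : H = (R 1)ᴴ * R 1 + ∑ g ∈ Finset.univ.erase 1, (R g)ᴴ * R g :=
      (Finset.add_sum_erase _ _ (Finset.mem_univ 1)).symm
    rw [h1]
    refine Matrix.PosDef.add_posSemidef ?_ ?_
    · simpa using Matrix.PosDef.one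
    · exact Matrix.posSemidef_sum _ fun g _ => Matrix.posSemidef_conjTranspose_mul_self _
  obtain ⟨B, hB⟩ := CStarAlgebra.nonneg_iff_eq_star_mul_self.mp hpos.posSemidef.nonneg
  rw [Matrix.star_eq_conjTranspose] at hB
  have hBu : IsUnit B := by
    rw [Matrix.isUnit_iff_isUnit_det]
    have := (Matrix.isUnit_iff_isUnit_det _).1 hpos.isUnit
    rw [hB, Matrix.det_mul] at this
    exact isUnit_of_mul_isUnit_right this
  have hBd := (Matrix.isUnit_iff_isUnit_det _).1 hBu
  -- The averaged form `H` is invariant.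
  have hinv : ∀ g, (R g)ᴴ * H * R g = H := fun g => by
    simp only [H, Finset.mul_sum, Finset.sum_mul]
    refine Fintype.sum_bijective (· * g) (Group.mulRight_bijective g) _ _ fun x => ?_
    simp [Matrix.mul_assoc]
  have hU : ∀ g, B * R g * B⁻¹ ∈ Matrix.unitaryGroup (Fin d) ℂ := fun g => by
    rw [Matrix.mem_unitaryGroup_iff', Matrix.star_eq_conjTranspose]
    calc (B * R g * B⁻¹)ᴴ * (B * R g * B⁻¹)
        = (B⁻¹)ᴴ * ((R g)ᴴ * (Bᴴ * B) * R g) * B⁻¹ := by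
          simp only [Matrix.conjTranspose_mul, Matrix.mul_assoc]
      _ = (B * B⁻¹)ᴴ * (B * B⁻¹) := by
          rw [← hB, hinv, hB]
          simp only [Matrix.conjTranspose_mul, Matrix.mul_assoc]
      _ = 1 := by simp [Matrix.mul_nonsing_inv _ hBd]
  refine ⟨{ toFun := fun g => ⟨B * R g * B⁻¹, hU g⟩, map_one' := ?_, map_mul' := ?_ }, ⟨?_⟩⟩
  · ext1; simp [Matrix.mul_nonsing_inv _ hBd]
  · intro x y
    ext1
    simp only [map_mul, Submonoid.coe_mul, Matrix.mul_assoc,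
      Matrix.nonsing_inv_mul_cancel_left _ _ hBd]
  · refine Representation.Equiv.mk
      (LinearEquiv.ofLinearMap (Matrix.toLin' B) (Matrix.toLin' B⁻¹) ?_ ?_) fun g => ?_
    · rw [← Matrix.toLin'_mul, Matrix.mul_nonsing_inv _ hBd, Matrix.toLin'_one]
    · rw [← Matrix.toLin'_mul, Matrix.nonsing_inv_mul _ hBd, Matrix.toLin'_one]
    · refine LinearMap.ext fun v => ?_
      have hρ : ρ g v = R g *ᵥ v := (LinearMap.toMatrix'_mulVec (ρ g) v).symm
      change B *ᵥ (ρ g v) = (B * R g * B⁻¹) *ᵥ (B *ᵥ v)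
      rw [hρ, Matrix.mulVec_mulVec, Matrix.mulVec_mulVec, Matrix.mul_assoc _ B⁻¹,
        Matrix.nonsing_inv_mul _ hBd, Matrix.mul_one]

end UnitaryRepresentations

/-! ### Complete lists of irreducible representations -/

theorem trivial_isIrreducible (G : Type) [Group G] :
    (toRep (1 : G →* Matrix.unitaryGroup (Fin 1) ℂ)).IsIrreducible where
  exists_pair_ne := ⟨⊥, ⊤, fun h => by
    have h1 : (1 : Fin 1 → ℂ) ∈ (⊥ : Submodule ℂ (Fin 1 → ℂ)) := by
      rw [show (⊥ : Submodule ℂ (Fin 1 → ℂ)) = ⊤ from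
        congrArg Subrepresentation.toSubmodule h]
      trivial
    exact one_ne_zero ((Submodule.mem_bot ℂ).1 h1)⟩
  eq_bot_or_eq_top W := by
    have : IsSimpleOrder (Submodule ℂ (Fin 1 → ℂ)) :=
      (isSimpleModule_iff ℂ _).1 (isSimpleModule_iff_finrank_eq_one.2 (by simp))
    rcases eq_bot_or_eq_top W.toSubmodule with h | h
    · exact Or.inl (Subrepresentation.toSubmodule_injective h)
    · exact Or.inr (Subrepresentation.toSubmodule_injective h)

theorem dim_pos_of_isIrreducible {G : Type} [Group G] {d : ℕ}
    {D : G →* Matrix.unitaryGroup (Fin d) ℂ} (h : (toRep D).IsIrreducible) : 0 < d := by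
  rcases Nat.eq_zero_or_pos d with rfl | hd
  · obtain ⟨W₁, W₂, hW⟩ := h.exists_pair_ne
    exact absurd (Subrepresentation.toSubmodule_injective (Subsingleton.elim _ _)) hW
  · exact hd

section Existence

variable {G : Type} [Group G] [Fintype G]

/-- Pairwise inequivalent irreducible representations are finite in number: by Schur
orthogonality their upper left matrix coefficients are linearly independent functions on `G`. -/
theorem finite_of_pairwise_inequivalent {ι : Type*} {d : ι → ℕ}
    (D : ∀ i, G →* Matrix.unitaryGroup (Fin (d i)) ℂ) (hD : ∀ i, (toRep (D i)).IsIrreducible)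
    (hne : ∀ i j, Nonempty ((toRep (D i)).Equiv (toRep (D j))) → i = j) : Finite ι := by
  let z : ∀ i, Fin (d i) := fun i => ⟨0, dim_pos_of_isIrreducible (hD i)⟩
  let f : ι → G → ℂ := fun i g => (D i g).1 (z i) (z i)
  suffices LinearIndependent ℂ f from this.finite
  rw [linearIndependent_iff']
  intro s c hc j hj
  have h1 : ∑ g, (∑ i ∈ s, c i • f i) g * star (f j g) = 0 := by rw [hc]; simp
  simp only [Finset.sum_apply, Pi.smul_apply, smul_eq_mul, Finset.sum_mul] at h1
  rw [Finset.sum_comm, Finset.sum_eq_single_of_mem j hj] at h1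
  · simp only [mul_assoc, ← Finset.mul_sum] at h1
    have h2 := schur_orthogonality_self (hD j) (z j) (z j) (z j) (z j)
    rw [if_pos ⟨rfl, rfl⟩] at h2
    rcases mul_eq_zero.1 h1 with h | h
    · exact h
    · rw [h, mul_zero] at h2
      exact absurd h2.symm (Nat.cast_ne_zero.2 Fintype.card_ne_zero)
  · intro i _ hij
    simp only [mul_assoc, ← Finset.mul_sum]
    rw [schur_orthogonality_of_isEmpty (hD i) (hD j)
      ⟨fun φ => hij (hne j i ⟨φ⟩).symm⟩, mul_zero]

/-- There is a complete list of irreducible representations in which a given irreducible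
representation by unitary matrices represents its own class. -/
theorem exists_irrepSystem_of_isIrreducible {d : ℕ} (D₀ : G →* Matrix.unitaryGroup (Fin d) ℂ)
    (h₀ : (toRep D₀).IsIrreducible) :
    ∃ (S : IrrepSystem G) (ν : Fin S.k),
      (⟨S.dim ν, S.D ν⟩ : Σ d : ℕ, G →* Matrix.unitaryGroup (Fin d) ℂ) = ⟨d, D₀⟩ := by
  classical
  let T := {p : Σ d : ℕ, G →* Matrix.unitaryGroup (Fin d) ℂ // (toRep p.2).IsIrreducible}
  let r : Setoid T :=
    { r := fun p q => Nonempty ((toRep p.1.2).Equiv (toRep q.1.2))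
      iseqv := ⟨fun _ => ⟨.refl _⟩, fun ⟨φ⟩ => ⟨φ.symm⟩, fun ⟨φ⟩ ⟨ψ⟩ => ⟨φ.trans ψ⟩⟩ }
  let t₀ : T := ⟨⟨d, D₀⟩, h₀⟩
  -- A section of the quotient map that picks `D₀` in its own class.
  let s : Quotient r → T := Function.update Quotient.out ⟦t₀⟧ t₀
  have hs : ∀ q, ⟦s q⟧ = q := fun q => by
    rcases eq_or_ne q ⟦t₀⟧ with rfl | hq
    · simp [s]
    · simp [s, Function.update_of_ne hq]
  have hne : ∀ p q, Nonempty ((toRep (s p).1.2).Equiv (toRep (s q).1.2)) → p = q :=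
    fun p q h => by rw [← hs p, ← hs q]; exact Quotient.sound h
  have : Finite (Quotient r) :=
    finite_of_pairwise_inequivalent (fun q => (s q).1.2) (fun q => (s q).2) hne
  let e := (Finite.equivFin (Quotient r)).symm
  refine ⟨{ k := Nat.card (Quotient r), dim := fun ν => (s (e ν)).1.1,
            D := fun ν => (s (e ν)).1.2, irreducible := fun ν => (s (e ν)).2,
            inequivalent := fun μ ν h => e.injective (hne _ _ h),
            complete := fun d ρ hρ => ?_ }, e.symm ⟦t₀⟧, ?_⟩
  · obtain ⟨D, ⟨φ⟩⟩ := exists_equiv_toRep ρ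
    let t : T := ⟨⟨d, D⟩, isIrreducible_of_equiv φ hρ⟩
    refine ⟨e.symm ⟦t⟧, ?_⟩
    rw [Equiv.apply_symm_apply]
    obtain ⟨ψ⟩ : Nonempty ((toRep t.1.2).Equiv (toRep (s ⟦t⟧).1.2)) :=
      Quotient.exact (hs ⟦t⟧).symm
    exact ⟨φ.trans ψ⟩
  · change (s (e (e.symm ⟦t₀⟧))).1 = t₀.1
    rw [Equiv.apply_symm_apply]
    simp [s]

end Existence

/-! ### Fourier inversion on a finite group -/

namespace IrrepSystem

section FourierInversion

variable {G : Type} [Group G] (S : IrrepSystem G)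

theorem exists_equiv_of_isIrreducible {V : Type*} [AddCommGroup V] [Module ℂ V]
    [FiniteDimensional ℂ V] (ρ : Representation ℂ G V) (hρ : ρ.IsIrreducible) :
    ∃ ν, Nonempty (ρ.Equiv (toRep (S.D ν))) := by
  let e : V ≃ₗ[ℂ] (Fin (Module.finrank ℂ V) → ℂ) := LinearEquiv.ofFinrankEq _ _ (by simp)
  let ρ' : Representation ℂ G (Fin (Module.finrank ℂ V) → ℂ) :=
    (LinearEquiv.conjAlgEquiv ℂ e).toMonoidHom.comp ρ
  let φ : ρ.Equiv ρ' := .mk e fun g => LinearMap.ext fun v => by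
    change e (ρ g v) = e (ρ g (e.symm (e v)))
    rw [e.symm_apply_apply]
  obtain ⟨ν, ⟨ψ⟩⟩ := S.complete _ ρ' (isIrreducible_of_equiv φ hρ)
  exact ⟨ν, ⟨φ.trans ψ⟩⟩

theorem exists_isTrivial : ∃ ν, S.dim ν = 1 ∧ S.IsTrivial ν := by
  obtain ⟨ν, ⟨φ⟩⟩ := S.complete 1 _ (trivial_isIrreducible G)
  refine ⟨ν, ?_, fun g => ?_⟩
  · simpa using φ.toLinearEquiv.finrank_eq.symm
  · apply Subtype.ext
    apply Matrix.toLin'.injective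
    refine LinearMap.ext fun v => ?_
    have h : toRep (S.D ν) g (φ (φ.symm v)) = φ (φ.symm v) := by
      have h1 : φ (toRep 1 g (φ.symm v)) = toRep (S.D ν) g (φ (φ.symm v)) :=
        LinearMap.congr_fun (φ.toIntertwiningMap.isIntertwining' g) (φ.symm v)
      rw [← h1]
      exact congrArg φ (Matrix.one_mulVec _)
    rw [φ.apply_symm_apply] at h
    exact h.trans (Matrix.one_mulVec v).symm

variable [Fintype G]

/-- The coefficients with prescribed Fourier transform `A`:
`c_g = (1 / |G|) ∑_ν n_ν Tr (D^{(ν)}(g)† A^{(ν)})`. -/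
noncomputable def inverseFourier (A : ∀ ν, Matrix (Fin (S.dim ν)) (Fin (S.dim ν)) ℂ) (g : G) : ℂ :=
  (1 / (Fintype.card G : ℂ)) * ∑ ν, (S.dim ν : ℂ) * ((S.D ν g).1ᴴ * A ν).trace

theorem trace_conjTranspose_mul_eq {d : ℕ} (B A : Matrix (Fin d) (Fin d) ℂ) :
    (Bᴴ * A).trace = ∑ i, ∑ j, star (B i j) * A i j := by
  simp only [Matrix.trace, Matrix.diag_apply, Matrix.mul_apply, Matrix.conjTranspose_apply]
  exact Finset.sum_comm

theorem sum_coefficient_mul_star (μ ν : Fin S.k) (k l : Fin (S.dim μ))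
    (A : Matrix (Fin (S.dim ν)) (Fin (S.dim ν)) ℂ) :
    ∑ g, ((S.dim ν : ℂ) * ((S.D ν g).1ᴴ * A).trace) * (S.D μ g).1 k l =
      ∑ i, ∑ j, A i j * ((S.dim ν : ℂ) * ∑ g, (S.D μ g).1 k l * star ((S.D ν g).1 i j)) := by
  simp only [trace_conjTranspose_mul_eq, Finset.mul_sum, Finset.sum_mul]
  rw [Finset.sum_comm]
  refine Finset.sum_congr rfl fun i _ => ?_
  rw [Finset.sum_comm]
  exact Finset.sum_congr rfl fun j _ => Finset.sum_congr rfl fun g _ => by ring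

/-- Fourier inversion, from Schur orthogonality. -/
theorem sum_inverseFourier_smul (A : ∀ ν, Matrix (Fin (S.dim ν)) (Fin (S.dim ν)) ℂ)
    (μ : Fin S.k) : ∑ g, S.inverseFourier A g • (S.D μ g).1 = A μ := by
  have hG : (Fintype.card G : ℂ) ≠ 0 := Nat.cast_ne_zero.2 Fintype.card_ne_zero
  ext k l
  simp only [Matrix.sum_apply, Matrix.smul_apply, smul_eq_mul, inverseFourier, mul_assoc,
    ← Finset.mul_sum]
  simp only [Finset.sum_mul]
  rw [Finset.sum_comm, Finset.sum_eq_single μ]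
  · rw [sum_coefficient_mul_star]
    simp only [schur_orthogonality_self (S.irreducible μ)]
    rw [Finset.sum_eq_single k, Finset.sum_eq_single l]
    · simp only [and_self, if_true]
      field_simp
    · intro j _ hj
      simp [hj.symm]
    · simp
    · intro i _ hi
      simp [hi.symm]
    · simp
  · intro ν _ hν
    have hempty : IsEmpty ((toRep (S.D ν)).Equiv (toRep (S.D μ))) :=
      ⟨fun φ => hν (S.inequivalent ν μ ⟨φ⟩)⟩
    rw [sum_coefficient_mul_star]
    simp only [schur_orthogonality_of_isEmpty (S.irreducible μ) (S.irreducible ν) hempty,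
      mul_zero, Finset.sum_const_zero]
  · simp

/-- A function on `G` whose Fourier transform vanishes acts as zero in every finite-dimensional
representation, since by Maschke's theorem that representation is a sum of irreducible ones. -/
theorem sum_smul_apply_eq_zero {c : G → ℂ} (h : ∀ ν, ∑ g, c g • (S.D ν g).1 = 0)
    {V : Type*} [AddCommGroup V] [Module ℂ V] [FiniteDimensional ℂ V]
    (ρ : Representation ℂ G V) (v : V) : ∑ g, c g • ρ g v = 0 := by
  induction hn : Module.finrank ℂ V using Nat.strong_induction_on generalizing V with
  | _ n ih =>
  subst hn
  by_cases hρ : ρ.IsIrreducible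
  · obtain ⟨ν, ⟨φ⟩⟩ := S.exists_equiv_of_isIrreducible ρ hρ
    apply φ.toLinearEquiv.injective
    have h1 : ∀ g, φ.toLinearEquiv (ρ g v) = (S.D ν g).1 *ᵥ φ.toLinearEquiv v :=
      fun g => LinearMap.congr_fun (φ.toIntertwiningMap.isIntertwining' g) v
    simp only [map_sum, map_smul, h1, map_zero]
    simp only [← Matrix.smul_mulVec, ← Matrix.sum_mulVec, h, Matrix.zero_mulVec]
  · rcases subsingleton_or_nontrivial V with hV | hV
    · exact Subsingleton.elim _ _
    obtain ⟨W, hbot, htop⟩ : ∃ W : Subrepresentation ρ, W ≠ ⊥ ∧ W ≠ ⊤ := by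
      by_contra! hW
      have : (⊥ : Subrepresentation ρ) ≠ ⊤ := fun hbt =>
        bot_ne_top (α := Submodule ℂ V) (congrArg Subrepresentation.toSubmodule hbt)
      exact hρ
        { exists_pair_ne := ⟨⊥, ⊤, this⟩
          eq_bot_or_eq_top := fun W => or_iff_not_imp_left.2 (hW W) }
    have : NeZero (Nat.card G : ℂ) := ⟨Nat.cast_ne_zero.2 Nat.card_pos.ne'⟩
    obtain ⟨W', hW'⟩ := exists_isCompl W
    have htop' : W' ≠ ⊤ := fun h' => hbot (by rw [h'] at hW'; exact eq_bot_of_isCompl_top hW')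
    have hproper : ∀ Y : Subrepresentation ρ, Y ≠ ⊤ → ∀ y ∈ Y.toSubmodule,
        ∑ g, c g • ρ g y = 0 := fun Y hY y hy => by
      have hlt : Module.finrank ℂ Y.toSubmodule < Module.finrank ℂ V :=
        Submodule.finrank_lt fun h' => hY (Subrepresentation.toSubmodule_injective h')
      have h0 := congrArg Y.toSubmodule.subtype (ih _ hlt Y.toRepresentation ⟨y, hy⟩ rfl)
      rw [map_sum, map_zero] at h0
      exact h0
    have hv : v ∈ W.toSubmodule ⊔ W'.toSubmodule := by
      rw [← Subrepresentation.toSubmodule_sup, hW'.sup_eq_top]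
      trivial
    obtain ⟨w, hw, w', hw', rfl⟩ := Submodule.mem_sup.1 hv
    simp only [map_add, smul_add, Finset.sum_add_distrib, hproper W htop w hw,
      hproper W' htop' w' hw', add_zero]

/-- A function on `G` is determined by its Fourier transform, as it acts faithfully in the regular
representation. -/
theorem eq_zero_of_sum_smul_eq_zero {c : G → ℂ} (h : ∀ ν, ∑ g, c g • (S.D ν g).1 = 0) : c = 0 := by
  classical
  have h1 := S.sum_smul_apply_eq_zero h (Representation.leftRegular ℂ G)
    (MonoidAlgebra.single 1 1)
  funext g
  have := congrArg (fun y => MonoidAlgebra.coeff y g) h1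
  simpa [Finsupp.single_apply] using this

/-- The sum of the squares of the dimensions is the group order, since the Fourier transform is a
linear bijection. -/
theorem sum_dim_sq : ∑ ν, S.dim ν ^ 2 = Fintype.card G := by
  let Φ : (G → ℂ) →ₗ[ℂ] ∀ ν, Matrix (Fin (S.dim ν)) (Fin (S.dim ν)) ℂ :=
    LinearMap.pi fun ν => ∑ g, (LinearMap.proj g).smulRight (S.D ν g).1
  have hΦ : ∀ c ν, Φ c ν = ∑ g, c g • (S.D ν g).1 := fun c ν => by simp [Φ]
  have hbij : Function.Bijective Φ := by
    constructor
    · rw [injective_iff_map_eq_zero]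
      exact fun c hc => S.eq_zero_of_sum_smul_eq_zero fun ν => by rw [← hΦ, hc]; rfl
    · exact fun A => ⟨S.inverseFourier A, funext fun ν => by rw [hΦ, sum_inverseFourier_smul]⟩
  have h := (LinearEquiv.ofBijective Φ hbij).finrank_eq
  rw [Module.finrank_fintype_fun_eq_card, Module.finrank_pi_fintype] at h
  rw [h]
  exact Finset.sum_congr rfl fun ν _ => by simp [Module.finrank_matrix, sq]

/-- Plancherel's formula: if all the matrices of the Fourier transform are unitary, the sum of
`|c_g|²` is `(1 / |G|) ∑_ν n_ν ^ 2 = 1`. -/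
theorem sum_norm_sq_inverseFourier (U : ∀ ν, Matrix.unitaryGroup (Fin (S.dim ν)) ℂ) :
    ∑ g, ‖S.inverseFourier (fun ν => (U ν).1) g‖ ^ 2 = 1 := by
  set c := S.inverseFourier (fun ν => (U ν).1) with hc
  have hG : (Fintype.card G : ℂ) ≠ 0 := Nat.cast_ne_zero.2 Fintype.card_ne_zero
  have hstar : ∀ g, star (c g) =
      (1 / (Fintype.card G : ℂ)) * ∑ ν, (S.dim ν : ℂ) * ((U ν).1ᴴ * (S.D ν g).1).trace := fun g => by
    simp only [hc, inverseFourier, star_mul', star_sum, star_div₀, star_one, star_natCast,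
      ← Matrix.trace_conjTranspose, Matrix.conjTranspose_mul, Matrix.conjTranspose_conjTranspose]
  have hsum : ∑ g, c g * star (c g) = 1 := by
    calc ∑ g, c g * star (c g)
        = (1 / (Fintype.card G : ℂ)) * ∑ ν, (S.dim ν : ℂ) *
            ((U ν).1ᴴ * ∑ g, c g • (S.D ν g).1).trace := by
          simp only [hstar, Finset.mul_sum, Matrix.trace_sum, Matrix.mul_smul,
            Matrix.trace_smul, smul_eq_mul]
          rw [Finset.sum_comm]
          exact Finset.sum_congr rfl fun ν _ => Finset.sum_congr rfl fun g _ => by ring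
      _ = (1 / (Fintype.card G : ℂ)) * ∑ ν, (S.dim ν : ℂ) ^ 2 := by
          congr 1
          refine Finset.sum_congr rfl fun ν _ => ?_
          rw [hc, sum_inverseFourier_smul, ← Matrix.star_eq_conjTranspose,
            Matrix.UnitaryGroup.star_mul_self, Matrix.trace_one, Fintype.card_fin, sq]
      _ = 1 := by
          have := congrArg (Nat.cast : ℕ → ℂ) S.sum_dim_sq
          push_cast at this
          rw [this, one_div_mul_cancel hG]
  have h2 : ∀ g, c g * star (c g) = ((‖c g‖ ^ 2 : ℝ) : ℂ) := fun g => by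
    rw [Complex.star_def, Complex.mul_conj']; simp
  simp only [h2, ← Complex.ofReal_sum] at hsum
  exact_mod_cast hsum

end FourierInversion

end IrrepSystem

/-! ### The Fourier matrix and the block form of `XU(n)` -/

theorem fourierMat_mem_unitaryGroup (m : ℕ) :
    fourierMat (m + 1) ∈ Matrix.unitaryGroup (Fin (m + 1)) ℂ := by
  rw [Matrix.mem_unitaryGroup_iff', Matrix.star_eq_conjTranspose]
  set ω : ℂ := Complex.exp (2 * Real.pi * Complex.I / (m + 1 : ℕ)) with hω
  have hprim : IsPrimitiveRoot ω (m + 1) := Complex.isPrimitiveRoot_exp _ (by omega)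
  have hstar : star ω = ω⁻¹ := by
    have h1 : ‖ω‖ = 1 := hprim.norm'_eq_one (by omega)
    rw [Complex.inv_def, Complex.normSq_eq_norm_sq, h1]
    simp
  have hω0 : ω ≠ 0 := Complex.exp_ne_zero _
  have hs : ((Real.sqrt (m + 1 : ℕ) : ℝ) : ℂ) * (Real.sqrt (m + 1 : ℕ) : ℝ) = (m + 1 : ℕ) := by
    rw [← Complex.ofReal_mul, Real.mul_self_sqrt (by positivity)]
    simp
  ext i j
  have hterm : ∀ k : Fin (m + 1), (fourierMat (m + 1))ᴴ i k * fourierMat (m + 1) k j =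
      (1 / (m + 1 : ℕ) : ℂ) * ((ω⁻¹) ^ (i : ℕ) * ω ^ (j : ℕ)) ^ (k : ℕ) := fun k => by
    rw [Matrix.conjTranspose_apply]
    simp only [fourierMat, Matrix.of_apply, ← hω, star_div₀, star_pow, hstar]
    rw [show star ((Real.sqrt (m + 1 : ℕ) : ℝ) : ℂ) = (Real.sqrt (m + 1 : ℕ) : ℝ) from
      Complex.conj_ofReal _, div_mul_div_comm, hs, mul_pow, ← pow_mul, ← pow_mul,
      mul_comm (k : ℕ), mul_comm (k : ℕ)]
    ring
  rw [Matrix.mul_apply, Finset.sum_congr rfl fun k _ => hterm k, ← Finset.mul_sum,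
    Fin.sum_univ_eq_sum_range (fun k => ((ω⁻¹) ^ (i : ℕ) * ω ^ (j : ℕ)) ^ k)]
  have hm : ((m + 1 : ℕ) : ℂ) ≠ 0 := by exact_mod_cast Nat.succ_ne_zero m
  rcases eq_or_ne i j with rfl | hij
  · rw [← mul_pow, inv_mul_cancel₀ hω0]
    simp only [one_pow, Finset.sum_const, Finset.card_range, nsmul_eq_mul, mul_one,
      Matrix.one_apply_eq]
    exact one_div_mul_cancel hm
  · rw [Matrix.one_apply_ne hij]
    have hne : (ω⁻¹) ^ (i : ℕ) * ω ^ (j : ℕ) ≠ 1 := fun h => hij <| by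
      rw [inv_pow, inv_mul_eq_one₀ (pow_ne_zero _ hω0)] at h
      exact Fin.ext (hprim.pow_inj i.2 j.2 h)
    have hpow : ((ω⁻¹) ^ (i : ℕ) * ω ^ (j : ℕ)) ^ (m + 1) = 1 := by
      rw [mul_pow, ← pow_mul, ← pow_mul, mul_comm (i : ℕ), mul_comm (j : ℕ), pow_mul, pow_mul,
        inv_pow, hprim.pow_eq_one]
      simp
    rw [geom_sum_eq hne, hpow]
    simp

theorem fourierMat_apply_zero (m : ℕ) (i : Fin (m + 1)) :
    fourierMat (m + 1) i 0 = 1 / (Real.sqrt (m + 1 : ℕ) : ℂ) := by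
  simp [fourierMat]

theorem conjTranspose_fourierMat_mul_self (m : ℕ) :
    (fourierMat (m + 1))ᴴ * fourierMat (m + 1) = 1 :=
  Matrix.mem_unitaryGroup_iff'.1 (fourierMat_mem_unitaryGroup m)

theorem fourierMat_mul_conjTranspose_self (m : ℕ) :
    fourierMat (m + 1) * (fourierMat (m + 1))ᴴ = 1 :=
  Matrix.mem_unitaryGroup_iff.1 (fourierMat_mem_unitaryGroup m)

section OneDirectSum

variable {m : ℕ} (U V : Matrix (Fin m) (Fin m) ℂ)

@[simp] theorem oneDirectSum_zero_zero : oneDirectSum U 0 0 = 1 := rfl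

@[simp] theorem oneDirectSum_zero_succ (j : Fin m) : oneDirectSum U 0 j.succ = 0 := rfl

@[simp] theorem oneDirectSum_succ_zero (i : Fin m) : oneDirectSum U i.succ 0 = 0 := rfl

@[simp] theorem oneDirectSum_succ_succ (i j : Fin m) : oneDirectSum U i.succ j.succ = U i j := rfl

theorem oneDirectSum_mul : oneDirectSum U * oneDirectSum V = oneDirectSum (U * V) := by
  ext i j
  refine Fin.cases ?_ (fun i => ?_) i <;> refine Fin.cases ?_ (fun j => ?_) j <;>
    simp [Matrix.mul_apply, Fin.sum_univ_succ]

theorem oneDirectSum_conjTranspose : (oneDirectSum U)ᴴ = oneDirectSum Uᴴ := by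
  ext i j
  refine Fin.cases ?_ (fun i => ?_) i <;> refine Fin.cases ?_ (fun j => ?_) j <;> simp

theorem oneDirectSum_one : oneDirectSum (1 : Matrix (Fin m) (Fin m) ℂ) = 1 := by
  ext i j
  refine Fin.cases ?_ (fun i => ?_) i <;> refine Fin.cases ?_ (fun j => ?_) j <;>
    simp [Matrix.one_apply, Fin.succ_ne_zero, (Fin.succ_ne_zero _).symm]

theorem oneDirectSum_injective :
    Function.Injective (oneDirectSum : Matrix (Fin m) (Fin m) ℂ → _) := fun U V h => by
  ext i j
  simpa using congrFun (congrFun h i.succ) j.succ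

end OneDirectSum

/-- The first column of `F` is constant, so it is fixed by `X` and by `X†` when all row and column
sums of `X` are `1`. -/
theorem eq_oneDirectSum_of_mem_XU {m : ℕ} {X : Matrix (Fin (m + 1)) (Fin (m + 1)) ℂ}
    (hX : X ∈ XU (m + 1)) :
    (fourierMat (m + 1))ᴴ * X * fourierMat (m + 1) = oneDirectSum
      (((fourierMat (m + 1))ᴴ * X * fourierMat (m + 1)).submatrix Fin.succ Fin.succ) := by
  obtain ⟨-, hrow, hcol⟩ := hX
  set F := fourierMat (m + 1) with hF
  have h1 : ∀ i, (X * F) i 0 = F i 0 := fun i => by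
    simp only [Matrix.mul_apply, hF, fourierMat_apply_zero, ← Finset.sum_mul, hrow, one_mul]
  have h2 : ∀ j, (Fᴴ * X) 0 j = Fᴴ 0 j := fun j => by
    simp only [Matrix.mul_apply, hF, Matrix.conjTranspose_apply, fourierMat_apply_zero,
      ← Finset.mul_sum, hcol, mul_one]
  have h3 : ∀ i, (Fᴴ * X * F) i 0 = (1 : Matrix (Fin (m + 1)) (Fin (m + 1)) ℂ) i 0 := fun i => by
    rw [← conjTranspose_fourierMat_mul_self, ← hF, Matrix.mul_assoc, Matrix.mul_apply,
      Matrix.mul_apply]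
    simp only [h1]
  have h4 : ∀ j, (Fᴴ * X * F) 0 j = (1 : Matrix (Fin (m + 1)) (Fin (m + 1)) ℂ) 0 j := fun j => by
    rw [← conjTranspose_fourierMat_mul_self, ← hF, Matrix.mul_apply, Matrix.mul_apply]
    simp only [h2]
  ext i j
  refine Fin.cases ?_ (fun i => ?_) i <;> refine Fin.cases ?_ (fun j => ?_) j
  · simp [h3]
  · rw [h4]; simp [(Fin.succ_ne_zero _).symm]
  · rw [h3]; simp
  · simp

theorem submatrix_mem_unitaryGroup_of_mem_XU {m : ℕ}
    {X : Matrix (Fin (m + 1)) (Fin (m + 1)) ℂ} (hX : X ∈ XU (m + 1)) :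
    ((fourierMat (m + 1))ᴴ * X * fourierMat (m + 1)).submatrix Fin.succ Fin.succ ∈
      Matrix.unitaryGroup (Fin m) ℂ := by
  have h1 := eq_oneDirectSum_of_mem_XU hX
  have h2 : (fourierMat (m + 1))ᴴ * X * fourierMat (m + 1) ∈ Matrix.unitaryGroup _ ℂ :=
    mul_mem (mul_mem (Unitary.star_mem (fourierMat_mem_unitaryGroup m)) hX.1)
      (fourierMat_mem_unitaryGroup m)
  rw [h1, Matrix.mem_unitaryGroup_iff', Matrix.star_eq_conjTranspose, oneDirectSum_conjTranspose,
    oneDirectSum_mul, ← oneDirectSum_one] at h2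
  exact Matrix.mem_unitaryGroup_iff'.2 (oneDirectSum_injective h2)

theorem permMat_mul {n : ℕ} (σ τ : Equiv.Perm (Fin n)) :
    permMat (σ * τ) = permMat σ * permMat τ := map_mul Matrix.permMatrixHom σ τ

theorem permMat_one {n : ℕ} : permMat (1 : Equiv.Perm (Fin n)) = 1 :=
  map_one Matrix.permMatrixHom

theorem permMat_mulVec {n : ℕ} (σ : Equiv.Perm (Fin n)) (v : Fin n → ℂ) :
    permMat σ *ᵥ v = v ∘ ⇑σ⁻¹ := by
  ext i
  have h : ∀ j, i = σ j ↔ σ⁻¹ i = j := fun j => Equiv.Perm.inv_eq_iff_eq.symm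
  simp [Matrix.mulVec, dotProduct, permMat_apply, h]

theorem permMat_mem_XU {n : ℕ} (σ : Equiv.Perm (Fin n)) : permMat σ ∈ XU n := by
  refine ⟨?_, fun i => ?_, fun j => ?_⟩
  · have h : (permMat σ)ᴴ = permMat σ⁻¹ := by
      ext i j
      have h : j = σ i ↔ i = σ⁻¹ j := eq_comm.trans Equiv.Perm.eq_inv_iff_eq.symm
      simp [permMat_apply, h]
    rw [Matrix.mem_unitaryGroup_iff', Matrix.star_eq_conjTranspose, h, ← permMat_mul,
      inv_mul_cancel, permMat_one]
  · have h : ∀ j, i = σ j ↔ σ⁻¹ i = j := fun j => Equiv.Perm.inv_eq_iff_eq.symm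
    simp [permMat_apply, h]
  · simp [permMat_apply]

theorem fourier_permMat {m : ℕ} (σ : Equiv.Perm (Fin (m + 1))) :
    (fourierMat (m + 1))ᴴ * permMat σ * fourierMat (m + 1) = oneDirectSum (standardMat σ) :=
  eq_oneDirectSum_of_mem_XU (permMat_mem_XU σ)

/-- The standard representation `D^{(s)}` as a homomorphism into the unitary group. -/
noncomputable def standardHom (m : ℕ) :
    Equiv.Perm (Fin (m + 1)) →* Matrix.unitaryGroup (Fin m) ℂ where
  toFun σ := ⟨standardMat σ, submatrix_mem_unitaryGroup_of_mem_XU (permMat_mem_XU σ)⟩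
  map_one' := by
    apply Subtype.ext
    apply oneDirectSum_injective
    change oneDirectSum (standardMat 1) = oneDirectSum 1
    rw [← fourier_permMat, permMat_one, Matrix.mul_one, conjTranspose_fourierMat_mul_self,
      oneDirectSum_one]
  map_mul' σ τ := by
    apply Subtype.ext
    apply oneDirectSum_injective
    change oneDirectSum (standardMat (σ * τ)) = oneDirectSum (standardMat σ * standardMat τ)
    rw [← oneDirectSum_mul, ← fourier_permMat, ← fourier_permMat, ← fourier_permMat, permMat_mul]
    simp only [Matrix.mul_assoc]
    rw [← Matrix.mul_assoc (fourierMat (m + 1)) (fourierMat (m + 1))ᴴ,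
      fourierMat_mul_conjTranspose_self, Matrix.one_mul]

/-! ### Irreducibility of the standard representation -/

section Standard

variable {m : ℕ}

/-- The columns of the Fourier matrix but the first: an isometry of `ℂ ^ m` onto the vectors with
coordinate sum zero. -/
noncomputable def fourierCols (m : ℕ) : Matrix (Fin (m + 1)) (Fin m) ℂ :=
  (fourierMat (m + 1)).submatrix id Fin.succ

theorem conjTranspose_fourierCols_mul_self : (fourierCols m)ᴴ * fourierCols m = 1 := by
  have h := congrArg (fun M => M.submatrix Fin.succ Fin.succ) (conjTranspose_fourierMat_mul_self m)
  rw [Matrix.submatrix_one _ (Fin.succ_injective m)] at h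
  exact h

theorem conjTranspose_fourierCols_mul_permMat (σ : Equiv.Perm (Fin (m + 1))) :
    (fourierCols m)ᴴ * permMat σ = standardMat σ * (fourierCols m)ᴴ := by
  have h : (fourierMat (m + 1))ᴴ * permMat σ =
      oneDirectSum (standardMat σ) * (fourierMat (m + 1))ᴴ := by
    rw [← fourier_permMat, Matrix.mul_assoc, fourierMat_mul_conjTranspose_self, Matrix.mul_one]
  ext i j
  have := congrFun (congrFun h i.succ) j
  rw [Matrix.mul_apply, Matrix.mul_apply, Fin.sum_univ_succ (n := m)] at this
  simpa [Matrix.mul_apply, fourierCols, Fin.sum_univ_succ] using this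

theorem sum_fourierCols_mulVec (w : Fin m → ℂ) : ∑ i, (fourierCols m *ᵥ w) i = 0 := by
  have hcol : ∀ j : Fin m, ∑ i, fourierCols m i j = 0 := fun j => by
    have h := congrFun (congrFun (conjTranspose_fourierMat_mul_self m) 0) j.succ
    rw [Matrix.mul_apply, Matrix.one_apply_ne (Fin.succ_ne_zero j).symm] at h
    simp only [Matrix.conjTranspose_apply, fourierMat_apply_zero, ← Finset.mul_sum] at h
    refine (mul_eq_zero.1 h).resolve_left ?_
    have : (Real.sqrt (m + 1 : ℕ) : ℂ) ≠ 0 :=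
      Complex.ofReal_ne_zero.2 (Real.sqrt_ne_zero'.2 (by positivity))
    simpa using this
  simp only [Matrix.mulVec, dotProduct]
  rw [Finset.sum_comm]
  simp only [← Finset.sum_mul, hcol, zero_mul, Finset.sum_const_zero]

/-- Two distinct letters can be moved to any two distinct letters. -/
theorem exists_perm_apply_eq {α : Type*} [DecidableEq α] {i j a b : α} (hij : i ≠ j) (hab : a ≠ b) :
    ∃ σ : Equiv.Perm α, σ i = a ∧ σ j = b := by
  have h : Equiv.swap i a j ≠ a := fun h => hij <| by
    simpa using (Equiv.swap i a).injective ((Equiv.swap_apply_left i a).trans h.symm)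
  exact ⟨Equiv.swap (Equiv.swap i a j) b * Equiv.swap i a,
    by simp [Equiv.swap_apply_of_ne_of_ne h.symm hab], by simp⟩

/-- If `v = E w`, with `E = fourierCols m`, for a nonzero vector `w` of an invariant subspace, then
some coordinates `v i` and `v j` differ, and `v - P_(i j) v = (v i - v j) (e_i - e_j)`. So the
subspace contains the images under `E†` of all differences `e_a - e_b`, and these span. -/
theorem standardHom_isIrreducible (hm : 0 < m) : (toRep (standardHom m)).IsIrreducible := by
  set E := fourierCols m with hE
  have hEE : ∀ w, Eᴴ *ᵥ (E *ᵥ w) = w := fun w => by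
    rw [Matrix.mulVec_mulVec, hE, conjTranspose_fourierCols_mul_self, Matrix.one_mulVec]
  have hEP : ∀ σ v, Eᴴ *ᵥ (permMat σ *ᵥ v) = standardMat σ *ᵥ (Eᴴ *ᵥ v) := fun σ v => by
    rw [Matrix.mulVec_mulVec, Matrix.mulVec_mulVec, hE, conjTranspose_fourierCols_mul_permMat]
  have hpair : (⊥ : Subrepresentation (toRep (standardHom m))) ≠ ⊤ := fun h => by
    have : Nonempty (Fin m) := ⟨⟨0, hm⟩⟩
    exact bot_ne_top (α := Submodule ℂ (Fin m → ℂ)) (congrArg Subrepresentation.toSubmodule h)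
  refine { exists_pair_ne := ⟨⊥, ⊤, hpair⟩, eq_bot_or_eq_top := fun W => ?_ }
  by_cases hW : W.toSubmodule = ⊥
  · exact Or.inl (Subrepresentation.toSubmodule_injective hW)
  refine Or.inr (Subrepresentation.toSubmodule_injective (Submodule.eq_top_iff'.2 fun u => ?_))
  have hinv : ∀ σ, ∀ x ∈ W.toSubmodule, standardMat σ *ᵥ x ∈ W.toSubmodule :=
    fun σ x hx => W.apply_mem_toSubmodule σ hx
  obtain ⟨w, hw, hw0⟩ := (Submodule.ne_bot_iff _).1 hW
  set v := E *ᵥ w with hv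
  have hvsum : ∑ i, v i = 0 := sum_fourierCols_mulVec w
  obtain ⟨i, j, hij⟩ : ∃ i j, v i ≠ v j := by
    by_contra! hconst
    have h0 : v = 0 := by
      funext i
      rw [Finset.sum_congr rfl fun j _ => hconst j i] at hvsum
      simpa [Nat.cast_add_one_ne_zero] using hvsum
    exact hw0 (by rw [← hEE w, ← hv, h0, Matrix.mulVec_zero])
  have hne : i ≠ j := fun h => hij (by rw [h])
  -- The differences of basis vectors: one from a transposition, the others by permuting letters.
  have hdiff : ∀ a b, Eᴴ *ᵥ (Pi.single a 1 - Pi.single b 1) ∈ W.toSubmodule := by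
    have hswap : v - permMat (Equiv.swap i j) *ᵥ v =
        (v i - v j) • (Pi.single i 1 - Pi.single j 1) := by
      rw [permMat_mulVec, Equiv.swap_inv]
      funext k
      rcases eq_or_ne k i with rfl | hki
      · simp [hne]
      rcases eq_or_ne k j with rfl | hkj
      · simp [hki]
      · simp [Equiv.swap_apply_of_ne_of_ne hki hkj, hki, hkj]
    have h1 : Eᴴ *ᵥ (Pi.single i 1 - Pi.single j 1) ∈ W.toSubmodule := by
      have h2 : w - standardMat (Equiv.swap i j) *ᵥ w =
          (v i - v j) • (Eᴴ *ᵥ (Pi.single i 1 - Pi.single j 1)) := by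
        rw [← Matrix.mulVec_smul, ← hswap, Matrix.mulVec_sub, hEP, hv, hEE]
      rw [← Submodule.smul_mem_iff _ (sub_ne_zero.2 hij), ← h2]
      exact sub_mem hw (hinv _ w hw)
    intro a b
    rcases eq_or_ne a b with rfl | hab
    · simp
    obtain ⟨σ, rfl, rfl⟩ := exists_perm_apply_eq hne hab
    have h3 : ∀ k, permMat σ *ᵥ Pi.single k 1 = Pi.single (σ k) 1 := fun k => by
      funext l
      simp [permMat_apply, Pi.single_apply]
    rw [← h3, ← h3, ← Matrix.mulVec_sub, hEP]
    exact hinv σ _ h1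
  -- The term at `0` drops out because the coordinates of `E u` sum to zero.
  have hu : u = ∑ a, (E *ᵥ u) a • (Eᴴ *ᵥ (Pi.single a 1 - Pi.single 0 1)) := by
    simp only [← Matrix.mulVec_smul, ← Matrix.mulVec_sum, smul_sub, Finset.sum_sub_distrib,
      ← Finset.sum_smul]
    rw [hE, sum_fourierCols_mulVec, zero_smul, sub_zero, ← pi_eq_sum_univ', ← hE, hEE]
  rw [hu]
  exact sum_mem fun a _ => Submodule.smul_mem _ _ (hdiff a 0)

end Standard

theorem exists_hasStandard (m : ℕ) :
    ∃ S : IrrepSystem (Equiv.Perm (Fin (m + 1))), S.HasStandard := by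
  rcases Nat.eq_zero_or_pos m with rfl | hm
  -- On one letter the condition is void, and any complete list will do.
  · obtain ⟨S, -⟩ := exists_irrepSystem_of_isIrreducible _
      (trivial_isIrreducible (Equiv.Perm (Fin (0 + 1))))
    exact ⟨S, fun h => absurd h (lt_irrefl 0)⟩
  · obtain ⟨S, ν, hν⟩ := exists_irrepSystem_of_isIrreducible _ (standardHom_isIrreducible hm)
    have hcast : ∀ p : Σ d : ℕ, Equiv.Perm (Fin (m + 1)) →* Matrix.unitaryGroup (Fin d) ℂ,
        p = ⟨m, standardHom m⟩ → ∃ h : p.1 = m, ∀ σ, (p.2 σ).1 =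
          (standardMat σ).submatrix (Fin.cast h) (Fin.cast h) := by
      rintro _ rfl
      exact ⟨rfl, fun σ => rfl⟩
    exact ⟨S, fun _ => ⟨ν, hcast _ hν⟩⟩

/-! ### The coefficients on the symmetric group -/

namespace IrrepSystem

variable {m : ℕ} (S : IrrepSystem (Equiv.Perm (Fin (m + 1))))

theorem coeff_eq_inverseFourier (U : ∀ ν, Matrix.unitaryGroup (Fin (S.dim ν)) ℂ)
    (σ : Equiv.Perm (Fin (m + 1))) :
    S.coeff U σ = S.inverseFourier (fun ν => (U ν).1) σ := by
  rw [coeff, inverseFourier, Fintype.card_perm, Fintype.card_fin]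

/-- The two prescriptions for `U` never clash: conjugating back by the Fourier matrix, a trivial
standard representation would make all permutation matrices equal to `1`. -/
theorem not_isTrivial_of_isStandard {ν : Fin S.k} (h : S.IsStandard ν) : ¬ S.IsTrivial ν := by
  intro htriv
  obtain ⟨hd, hD⟩ := h
  have hm : 0 < m := hd ▸ dim_pos_of_isIrreducible (S.irreducible ν)
  have hstd : ∀ σ : Equiv.Perm (Fin (m + 1)), standardMat σ = 1 := fun σ => by
    ext i j
    have h1 := congrFun (congrFun (hD σ) (Fin.cast hd.symm i)) (Fin.cast hd.symm j)
    rw [htriv σ] at h1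
    simpa [Matrix.one_apply] using h1.symm
  have hperm : permMat (Equiv.swap (0 : Fin (m + 1)) (Fin.last m)) = 1 := by
    have h1 := fourier_permMat (Equiv.swap (0 : Fin (m + 1)) (Fin.last m))
    rw [hstd, oneDirectSum_one, mul_eq_one_comm, ← Matrix.mul_assoc,
      fourierMat_mul_conjTranspose_self, Matrix.one_mul] at h1
    exact h1
  have hlast : (0 : Fin (m + 1)) ≠ Fin.last m := fun h => hm.ne (congrArg Fin.val h)
  have h0 := congrFun (congrFun hperm 0) 0
  rw [permMat_apply, Equiv.swap_apply_left, if_neg hlast, Matrix.one_apply_eq] at h0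
  exact zero_ne_one h0

theorem exists_admissible {Us : Matrix (Fin m) (Fin m) ℂ}
    (hUs : Us ∈ Matrix.unitaryGroup (Fin m) ℂ) : ∃ U, S.Admissible Us U := by
  classical
  have hcast : ∀ {ν} (h : S.dim ν = m), Us.submatrix (Fin.cast h) (Fin.cast h) ∈
      Matrix.unitaryGroup (Fin (S.dim ν)) ℂ := fun {ν} h => by
    have key : ∀ d (h : d = m), Us.submatrix (Fin.cast h) (Fin.cast h) ∈
        Matrix.unitaryGroup (Fin d) ℂ := by
      rintro _ rfl
      exact hUs
    exact key _ h
  refine ⟨fun ν => if h : S.IsStandard ν then ⟨_, hcast h.1⟩ else 1, fun ν hν => ?_,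
    fun ν hν h => ?_⟩
  · exact dif_neg fun h => S.not_isTrivial_of_isStandard h hν
  · beta_reduce
    rw [dif_pos hν]

variable {Us : Matrix (Fin m) (Fin m) ℂ} {U : ∀ ν, Matrix.unitaryGroup (Fin (S.dim ν)) ℂ}

theorem sum_coeff_eq_one (hU : S.Admissible Us U) : ∑ σ, S.coeff U σ = 1 := by
  obtain ⟨ν, hd, hν⟩ := S.exists_isTrivial
  have h := S.sum_inverseFourier_smul (fun ν => (U ν).1) ν
  have h0 := congrFun (congrFun h ⟨0, by omega⟩) ⟨0, by omega⟩
  rw [hU.1 ν hν] at h0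
  simpa [Matrix.sum_apply, hν _, coeff_eq_inverseFourier] using h0

theorem sum_coeff_smul_standardMat (hS : S.HasStandard) (hU : S.Admissible Us U) :
    ∑ σ, S.coeff U σ • standardMat σ = Us := by
  rcases Nat.eq_zero_or_pos m with rfl | hm
  · exact Subsingleton.elim _ _
  obtain ⟨ν, hν⟩ := hS hm
  obtain ⟨hd, hD⟩ := hν
  have h := S.sum_inverseFourier_smul (fun ν => (U ν).1) ν
  rw [hU.2 ν ⟨hd, hD⟩ hd] at h
  ext i j
  have h0 := congrFun (congrFun h (Fin.cast hd.symm i)) (Fin.cast hd.symm j)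
  simpa [Matrix.sum_apply, hD, coeff_eq_inverseFourier] using h0

/-- Conjugated by `F`, both sides are block diagonal; the blocks agree by Fourier inversion at the
trivial and at the standard representation. -/
theorem sum_coeff_smul_permMat (hS : S.HasStandard) (hU : S.Admissible Us U)
    {X : Matrix (Fin (m + 1)) (Fin (m + 1)) ℂ}
    (hX : (fourierMat (m + 1))ᴴ * X * fourierMat (m + 1) = oneDirectSum Us) :
    X = ∑ σ, S.coeff U σ • permMat σ := by
  have hconj : ∀ Y : Matrix (Fin (m + 1)) (Fin (m + 1)) ℂ,
      Y = fourierMat (m + 1) * ((fourierMat (m + 1))ᴴ * Y * fourierMat (m + 1)) *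
        (fourierMat (m + 1))ᴴ := fun Y => by
    rw [← Matrix.mul_assoc, ← Matrix.mul_assoc, fourierMat_mul_conjTranspose_self, Matrix.one_mul,
      Matrix.mul_assoc, fourierMat_mul_conjTranspose_self, Matrix.mul_one]
  rw [hconj X, hconj (∑ σ, _), hX]
  congr 2
  simp only [Matrix.mul_sum, Matrix.sum_mul, Matrix.mul_smul, Matrix.smul_mul, fourier_permMat]
  ext i j
  rw [Matrix.sum_apply]
  refine Fin.cases ?_ (fun i => ?_) i <;> refine Fin.cases ?_ (fun j => ?_) j
  · simpa using (S.sum_coeff_eq_one hU).symm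
  · simp
  · simp
  · rw [← S.sum_coeff_smul_standardMat hS hU]
    simp [Matrix.sum_apply]

end IrrepSystem

/-- The unitary Birkhoff theorem in dimension `n = m + 1 ≥ 1`, with explicit coefficients. -/
theorem theorem3 (m : ℕ) :
    (∃ S : IrrepSystem (Equiv.Perm (Fin (m + 1))), S.HasStandard) ∧
    ∀ X ∈ XU (m + 1),
      (∃ c : Equiv.Perm (Fin (m + 1)) → ℂ,
        X = ∑ σ, c σ • permMat σ ∧ ∑ σ, c σ = 1 ∧ ∑ σ, ‖c σ‖ ^ 2 = 1) ∧
      ∃ Us ∈ Matrix.unitaryGroup (Fin m) ℂ,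
        (fourierMat (m + 1))ᴴ * X * fourierMat (m + 1) = oneDirectSum Us ∧
        ∀ S : IrrepSystem (Equiv.Perm (Fin (m + 1))), S.HasStandard →
          (∃ U, S.Admissible Us U) ∧
          ∀ U : (∀ ν, Matrix.unitaryGroup (Fin (S.dim ν)) ℂ), S.Admissible Us U →
            (∀ σ, S.coeff U σ = (1 / ((m + 1).factorial : ℂ)) * ∑ ν, (S.dim ν : ℂ) *
              ∑ i, ∑ j, star ((S.D ν σ).1 i j) * (U ν).1 i j) ∧
            X = ∑ σ, S.coeff U σ • permMat σ ∧
            ∑ σ, S.coeff U σ = 1 ∧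
            ∑ σ, ‖S.coeff U σ‖ ^ 2 = 1 := by
  have hcoeff : ∀ X, ∀ Us : Matrix (Fin m) (Fin m) ℂ,
      (fourierMat (m + 1))ᴴ * X * fourierMat (m + 1) = oneDirectSum Us →
      ∀ S : IrrepSystem (Equiv.Perm (Fin (m + 1))), S.HasStandard → ∀ U, S.Admissible Us U →
        X = ∑ σ, S.coeff U σ • permMat σ ∧ ∑ σ, S.coeff U σ = 1 ∧
          ∑ σ, ‖S.coeff U σ‖ ^ 2 = 1 := fun X Us hXUs S hS U hU =>
    ⟨S.sum_coeff_smul_permMat hS hU hXUs, S.sum_coeff_eq_one hU, by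
      simpa only [IrrepSystem.coeff_eq_inverseFourier] using S.sum_norm_sq_inverseFourier U⟩
  refine ⟨exists_hasStandard m, fun X hX => ?_⟩
  have hUs := submatrix_mem_unitaryGroup_of_mem_XU hX
  have hXUs := eq_oneDirectSum_of_mem_XU hX
  refine ⟨?_, _, hUs, hXUs, fun S hS => ⟨S.exists_admissible hUs, fun U hU => ⟨fun σ => ?_, ?_⟩⟩⟩
  · obtain ⟨S, hS⟩ := exists_hasStandard m
    obtain ⟨U, hU⟩ := S.exists_admissible hUs
    exact ⟨S.coeff U, hcoeff X _ hXUs S hS U hU⟩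
  · simp only [IrrepSystem.coeff, IrrepSystem.trace_conjTranspose_mul_eq]
  · exact hcoeff X _ hXUs S hS U hU
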